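/- Let $N_a\ge 2$, $N_b\ge 2$ be integers and let $H$ be the real vector space of Hermitian operators on $\mathbb{C}^{N_a}\otimes\mathbb{C}^{N_b}$. Let $\mathcal{S}_1$ be the set of separable states, i.e. the convex hull of the pure product states $(\phi\otimes\chi)(\phi\otimes\chi)^\dagger$ with $\|\phi\|=\|\chi\|=1$. A witness is an $\Omega\in H$ with $\operatorname{Tr}(\Omega\rho)\ge 0$ for all $\rho\in\mathcal{S}_1$; it is a boundary witness if moreover $\operatorname{Tr}(\Omega\rho)=0$ for some $\rho\in\mathcal{S}_1$; it is extremal if $\operatorname{Tr}\Omega=1$ and $\Omega$ is an extreme point of the convex set of witnesses of trace one. Put $f_\Omega(\phi,\chi)=(\phi\otimes\chi)^\dagger\,\Omega\,(\phi\otimes\chi)$. A zero of $\Omega$ is a pair $(\phi,\chi)$ of nonzero vectors $\phi\in\mathbb{C}^{N_a}$, $\chi\in\mathbb{C}^{N_b}$ with $f_\Omega(\phi,\chi)=0$. A zero $(\phi_0,\chi_0)$ is quadratic if the part of $f_\Omega(\phi_0+\xi,\chi_0+\zeta)$ that is homogeneous of degree two in $(\xi,\zeta)$ is strictly positive for all $(\xi,\zeta)\ne(0,0)$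 with $\phi_0^\dagger\xi=0$ and $\chi_0^\dagger\zeta=0$ (equivalently, the Hessian of $f_\Omega$ in these real directions is positive definite). A quadratic witness is a boundary witness all of whose zeros are quadratic. Let $\Omega$ be an extremal quadratic witness. Then the product vectors $\phi\otimes\chi$, where $(\phi,\chi)$ runs over the zeros of $\Omega$, span the full Hilbert space $\mathbb{C}^{N_a}\otimes\mathbb{C}^{N_b}$. The partially conjugated vectors $\phi\otimes\chi^*$, where $(\phi,\chi)$ runs over the zeros of $\Omega$ and $\chi^*$ is the entrywise complex conjugate of $\chi$, also span $\mathbb{C}^{N_a}\otimes\mathbb{C}^{N_b}$. -/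

import Mathlib

open Matrix

namespace EntanglementWitness

noncomputable section

/-- The tensor product `φ ⊗ χ` of vectors of `ℂ^Na` and `ℂ^Nb`, in components
`(φ ⊗ χ)_{ij} = φ_i χ_j`, as a vector of `ℂ^Na ⊗ ℂ^Nb = ℂ^(Na × Nb)`. -/
def tensorVec {Na Nb : ℕ} (φ : Fin Na → ℂ) (χ : Fin Nb → ℂ) : Fin Na × Fin Nb → ℂ :=
  fun p => φ p.1 * χ p.2

/-- The pure product states `ψψ†`, where `ψ = φ ⊗ χ` with unit vectors `φ`, `χ`. -/
def pureProductStates (Na Nb : ℕ) : Set (Matrix (Fin Na × Fin Nb) (Fin Na × Fin Nb) ℂ) :=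
  {ρ | ∃ (φ : Fin Na → ℂ) (χ : Fin Nb → ℂ), star φ ⬝ᵥ φ = 1 ∧ star χ ⬝ᵥ χ = 1 ∧
    ρ = vecMulVec (tensorVec φ χ) (star (tensorVec φ χ))}

/-- The set of separable states (unit trace). -/
def separableStates (Na Nb : ℕ) : Set (Matrix (Fin Na × Fin Nb) (Fin Na × Fin Nb) ℂ) :=
  convexHull ℝ (pureProductStates Na Nb)

/-- The cone of unnormalized separable states. -/
def separableCone (Na Nb : ℕ) : Set (Matrix (Fin Na × Fin Nb) (Fin Na × Fin Nb) ℂ) :=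
  {σ | ∃ (t : ℝ) (ρ : Matrix (Fin Na × Fin Nb) (Fin Na × Fin Nb) ℂ),
    0 ≤ t ∧ ρ ∈ separableStates Na Nb ∧ σ = t • ρ}

/-- Entanglement witnesses: the dual cone, in the real space of Hermitian matrices with the inner
product `Tr (A B)`, of the cone of separable states. The trace of a product of Hermitian matrices
is real, so taking the real part loses nothing. -/
def witnesses (Na Nb : ℕ) : Set (Matrix (Fin Na × Fin Nb) (Fin Na × Fin Nb) ℂ) :=
  {Ω | Ω.IsHermitian ∧ ∀ ρ ∈ separableCone Na Nb, 0 ≤ (trace (Ω * ρ)).re}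

/-- Normalized (unit trace) entanglement witnesses. -/
def normalizedWitnesses (Na Nb : ℕ) : Set (Matrix (Fin Na × Fin Nb) (Fin Na × Fin Nb) ℂ) :=
  {Ω | Ω ∈ witnesses Na Nb ∧ trace Ω = 1}

/-- An extremal witness is an extreme point of the convex set of normalized witnesses. -/
def IsExtremalWitness {Na Nb : ℕ} (Ω : Matrix (Fin Na × Fin Nb) (Fin Na × Fin Nb) ℂ) : Prop :=
  Ω ∈ Set.extremePoints ℝ (normalizedWitnesses Na Nb)

/-- A boundary witness is a witness orthogonal to some separable state. -/
def IsBoundaryWitness {Na Nb : ℕ} (Ω : Matrix (Fin Na × Fin Nb) (Fin Na × Fin Nb) ℂ) : Prop :=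
  Ω ∈ witnesses Na Nb ∧ ∃ ρ ∈ separableStates Na Nb, trace (Ω * ρ) = 0

/-- The biquadratic form `f_A(φ, χ) = (φ ⊗ χ)† A (φ ⊗ χ)` (real when `A` is Hermitian). -/
def biquadraticForm {Na Nb : ℕ} (A : Matrix (Fin Na × Fin Nb) (Fin Na × Fin Nb) ℂ)
    (φ : Fin Na → ℂ) (χ : Fin Nb → ℂ) : ℝ :=
  (star (tensorVec φ χ) ⬝ᵥ (A *ᵥ tensorVec φ χ)).re

/-- A zero of `Ω` is a pair `(φ, χ)` of nonzero vectors at which the biquadratic form vanishes. -/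
def IsZero {Na Nb : ℕ} (Ω : Matrix (Fin Na × Fin Nb) (Fin Na × Fin Nb) ℂ)
    (φ : Fin Na → ℂ) (χ : Fin Nb → ℂ) : Prop :=
  φ ≠ 0 ∧ χ ≠ 0 ∧ biquadraticForm Ω φ χ = 0

/-- The Hessian form `z ↦ zᵀ G_Ω z` at `(φ₀, χ₀)`: the part of
`f_Ω(φ₀ + ξ, χ₀ + ζ)` that is homogeneous of degree two in `(ξ, ζ)`. -/
def hessianForm {Na Nb : ℕ} (Ω : Matrix (Fin Na × Fin Nb) (Fin Na × Fin Nb) ℂ)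
    (φ₀ : Fin Na → ℂ) (χ₀ : Fin Nb → ℂ) (ξ : Fin Na → ℂ) (ζ : Fin Nb → ℂ) : ℝ :=
  (star (tensorVec ξ χ₀) ⬝ᵥ (Ω *ᵥ tensorVec ξ χ₀)).re
    + (star (tensorVec φ₀ ζ) ⬝ᵥ (Ω *ᵥ tensorVec φ₀ ζ)).re
    + 2 * (star (tensorVec φ₀ ζ) ⬝ᵥ (Ω *ᵥ tensorVec ξ χ₀)
        + star (tensorVec φ₀ χ₀) ⬝ᵥ (Ω *ᵥ tensorVec ξ ζ)).re

/-- A quadratic zero: the Hessian, as a real quadratic form in the variations `ξ ⟂ φ₀` and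
`ζ ⟂ χ₀` (a real vector space of dimension `2 Na - 2 + 2 Nb - 2`), is positive definite. -/
def IsQuadraticZero {Na Nb : ℕ} (Ω : Matrix (Fin Na × Fin Nb) (Fin Na × Fin Nb) ℂ)
    (φ₀ : Fin Na → ℂ) (χ₀ : Fin Nb → ℂ) : Prop :=
  IsZero Ω φ₀ χ₀ ∧
    ∀ (ξ : Fin Na → ℂ) (ζ : Fin Nb → ℂ), star φ₀ ⬝ᵥ ξ = 0 → star χ₀ ⬝ᵥ ζ = 0 →
      (ξ, ζ) ≠ (0, 0) → 0 < hessianForm Ω φ₀ χ₀ ξ ζ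

/-- A quadratic witness is a boundary witness all of whose zeros are quadratic. -/
def IsQuadraticWitness {Na Nb : ℕ} (Ω : Matrix (Fin Na × Fin Nb) (Fin Na × Fin Nb) ℂ) : Prop :=
  IsBoundaryWitness Ω ∧ ∀ φ χ, IsZero Ω φ χ → IsQuadraticZero Ω φ χ

end

end EntanglementWitness

namespace EntanglementWitness

section

variable {Na Nb : ℕ}

/-! If the vectors `φ ⊗ σ(χ)` from the zeros of `Ω` (`σ` the identity or conjugation) do not span,
some `w ≠ 0` satisfies `w · (φ ⊗ σ(χ)) = 0` at every zero. The form `|w · (φ ⊗ σ(χ))|²` is, after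
normalization, that of a witness `Γ` of trace one vanishing at all zeros of `Ω`.

Quadratic zeros force `ε f_Γ ≤ f_Ω` for some `ε > 0` (`exists_mul_biquadraticForm_le`): near a zero
both forms are of second order in the orthogonal directions, the Hessian of `Ω` is definite there,
and compactness does the rest. So `Ω - ε Γ` is again a witness, and extremality gives `Γ = Ω`
(`eq_of_forall_isZero`).

But a squared modulus `|L(φ, χ)|²` has a zero that is not quadratic: the linearization of `L` takes
values in `ℂ`, while the orthogonal variations have real dimension at least four, so the Hessian
vanishes in some direction (`not_forall_isQuadraticZero_of_eq_norm_sq`). -/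

/-! ### Homogeneity of the biquadratic form and positivity of witnesses -/

lemma tensorVec_smul_smul (a b : ℂ) (φ : Fin Na → ℂ) (χ : Fin Nb → ℂ) :
    tensorVec (a • φ) (b • χ) = (a * b) • tensorVec φ χ := by
  ext p
  simp [tensorVec]
  ring

lemma tensorVec_add_smul_add_smul (φ ξ : Fin Na → ℂ) (χ ζ : Fin Nb → ℂ) (t : ℝ) :
    tensorVec (φ + t • ξ) (χ + t • ζ) =
      tensorVec φ χ + t • (tensorVec ξ χ + tensorVec φ ζ) + t ^ 2 • tensorVec ξ ζ := by
  ext p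
  simp [tensorVec]
  ring

lemma biquadraticForm_smul_smul (A : Matrix (Fin Na × Fin Nb) (Fin Na × Fin Nb) ℂ) (a b : ℂ)
    (φ : Fin Na → ℂ) (χ : Fin Nb → ℂ) :
    biquadraticForm A (a • φ) (b • χ) = ‖a * b‖ ^ 2 * biquadraticForm A φ χ := by
  unfold biquadraticForm
  rw [tensorVec_smul_smul, star_smul, mulVec_smul, smul_dotProduct, dotProduct_smul, smul_smul,
    smul_eq_mul]
  have h : star (a * b) * (a * b) = ((‖a * b‖ ^ 2 : ℝ) : ℂ) := by
    rw [Complex.star_def, ← Complex.normSq_eq_conj_mul_self, Complex.normSq_eq_norm_sq]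
  rw [h, Complex.re_ofReal_mul]

lemma biquadraticForm_smul (c : ℝ) (A : Matrix (Fin Na × Fin Nb) (Fin Na × Fin Nb) ℂ)
    (φ : Fin Na → ℂ) (χ : Fin Nb → ℂ) :
    biquadraticForm (c • A) φ χ = c * biquadraticForm A φ χ := by
  simp [biquadraticForm, smul_mulVec]

lemma biquadraticForm_sub (A B : Matrix (Fin Na × Fin Nb) (Fin Na × Fin Nb) ℂ)
    (φ : Fin Na → ℂ) (χ : Fin Nb → ℂ) :
    biquadraticForm (A - B) φ χ = biquadraticForm A φ χ - biquadraticForm B φ χ := by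
  simp [biquadraticForm, sub_mulVec]

lemma continuous_biquadraticForm (A : Matrix (Fin Na × Fin Nb) (Fin Na × Fin Nb) ℂ) :
    Continuous fun x : (Fin Na → ℂ) × (Fin Nb → ℂ) => biquadraticForm A x.1 x.2 := by
  simp only [biquadraticForm, tensorVec, dotProduct, mulVec, Pi.star_apply]
  fun_prop

open scoped ComplexOrder in
lemma exists_smul_dotProduct_eq_one {n : ℕ} (v : Fin n → ℂ) (hv : v ≠ 0) :
    ∃ a : ℂ, a ≠ 0 ∧ star (a • v) ⬝ᵥ (a • v) = 1 := by
  have hpos : 0 < star v ⬝ᵥ v := dotProduct_star_self_pos_iff.mpr hv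
  obtain ⟨r, hr, hre⟩ : ∃ r : ℝ, 0 < r ∧ star v ⬝ᵥ v = (r : ℂ) := by
    obtain ⟨h1, h2⟩ := Complex.lt_def.mp hpos
    exact ⟨_, h1, Complex.ext rfl (by simpa using h2.symm)⟩
  refine ⟨((√r)⁻¹ : ℝ), ?_, ?_⟩
  · simpa using (Real.sqrt_pos.mpr hr).ne'
  · rw [star_smul, smul_dotProduct, dotProduct_smul, hre]
    simp only [smul_eq_mul, Complex.star_def, Complex.conj_ofReal, ← Complex.ofReal_mul]
    norm_cast
    have := Real.mul_self_sqrt hr.le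
    have h0 := (Real.sqrt_pos.mpr hr).ne'
    field_simp
    linarith

lemma trace_mul_vecMulVec_star {n : Type*} [Fintype n] (A : Matrix n n ℂ) (v : n → ℂ) :
    trace (A * vecMulVec v (star v)) = star v ⬝ᵥ (A *ᵥ v) := by
  rw [mul_vecMulVec, trace_vecMulVec, dotProduct_comm]

/-- A Hermitian matrix is a witness iff its biquadratic form is nonnegative. -/
lemma mem_witnesses_iff (A : Matrix (Fin Na × Fin Nb) (Fin Na × Fin Nb) ℂ) :
    A ∈ witnesses Na Nb ↔ A.IsHermitian ∧ ∀ φ χ, 0 ≤ biquadraticForm A φ χ := by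
  refine and_congr_right fun _ => ⟨fun h φ χ => ?_, fun h σ hσ => ?_⟩
  · by_cases hφ : φ = 0
    · simp [biquadraticForm, tensorVec, hφ, dotProduct]
    by_cases hχ : χ = 0
    · simp [biquadraticForm, tensorVec, hχ, dotProduct]
    obtain ⟨a, ha, ha1⟩ := exists_smul_dotProduct_eq_one φ hφ
    obtain ⟨b, hb, hb1⟩ := exists_smul_dotProduct_eq_one χ hχ
    have key := h _ ⟨1, _, zero_le_one, subset_convexHull ℝ _ ⟨_, _, ha1, hb1, rfl⟩,
      (one_smul _ _).symm⟩
    rw [trace_mul_vecMulVec_star] at key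
    change 0 ≤ biquadraticForm A (a • φ) (b • χ) at key
    rw [biquadraticForm_smul_smul] at key
    have : 0 < ‖a * b‖ ^ 2 := by
      have := norm_pos_iff.mpr (mul_ne_zero ha hb)
      positivity
    exact nonneg_of_mul_nonneg_right key this
  · obtain ⟨t, ρ, ht, hρ, rfl⟩ := hσ
    have hconv : Convex ℝ {ρ : Matrix (Fin Na × Fin Nb) (Fin Na × Fin Nb) ℂ |
        0 ≤ (trace (A * ρ)).re} := by
      intro x hx y hy a b ha hb _
      simp only [Set.mem_ofPred_eq, mul_add, mul_smul_comm, trace_add, trace_smul, Complex.add_re,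
        Complex.smul_re, smul_eq_mul] at hx hy ⊢
      positivity
    have : ρ ∈ {ρ : Matrix (Fin Na × Fin Nb) (Fin Na × Fin Nb) ℂ | 0 ≤ (trace (A * ρ)).re} := by
      refine convexHull_min ?_ hconv hρ
      rintro _ ⟨φ, χ, -, -, rfl⟩
      simp only [Set.mem_ofPred_eq, trace_mul_vecMulVec_star]
      exact h φ χ
    simp only [Set.mem_ofPred_eq] at this
    simp only [mul_smul_comm, trace_smul, Complex.smul_re, smul_eq_mul]
    positivity

/-! ### Taylor expansion of the biquadratic form -/

/-- The cubic coefficient of `t ↦ f_A(φ + tξ, χ + tζ)`. -/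
def cubicTerm (A : Matrix (Fin Na × Fin Nb) (Fin Na × Fin Nb) ℂ)
    (φ : Fin Na → ℂ) (χ : Fin Nb → ℂ) (ξ : Fin Na → ℂ) (ζ : Fin Nb → ℂ) : ℝ :=
  2 * (star (tensorVec ξ χ + tensorVec φ ζ) ⬝ᵥ (A *ᵥ tensorVec ξ ζ)).re

lemma re_star_dotProduct_mulVec_comm {n : Type*} [Fintype n] {A : Matrix n n ℂ}
    (hA : A.IsHermitian) (u v : n → ℂ) :
    (star u ⬝ᵥ (A *ᵥ v)).re = (star v ⬝ᵥ (A *ᵥ u)).re := by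
  have : star (star v ⬝ᵥ (A *ᵥ u)) = star u ⬝ᵥ (A *ᵥ v) := by
    rw [star_dotProduct, star_star, star_mulVec, hA.eq, ← dotProduct_mulVec]
  rw [← this, Complex.star_def, Complex.conj_re]

lemma biquadraticForm_add_smul {A : Matrix (Fin Na × Fin Nb) (Fin Na × Fin Nb) ℂ}
    (hA : A.IsHermitian) (φ ξ : Fin Na → ℂ) (χ ζ : Fin Nb → ℂ) (t : ℝ) :
    biquadraticForm A (φ + t • ξ) (χ + t • ζ) = biquadraticForm A φ χ
      + t * (2 * (star (tensorVec φ χ) ⬝ᵥ (A *ᵥ (tensorVec ξ χ + tensorVec φ ζ))).re)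
      + t ^ 2 * (hessianForm A φ χ ξ ζ + t * cubicTerm A φ χ ξ ζ
        + t ^ 2 * biquadraticForm A ξ ζ) := by
  unfold biquadraticForm hessianForm cubicTerm
  rw [tensorVec_add_smul_add_smul]
  have h := re_star_dotProduct_mulVec_comm hA
  simp only [star_add, mulVec_add, add_dotProduct, dotProduct_add, star_smul, mulVec_smul,
    smul_dotProduct, dotProduct_smul, Complex.add_re, Complex.smul_re, smul_eq_mul, star_trivial]
  rw [h (tensorVec ξ χ) (tensorVec φ χ), h (tensorVec φ ζ) (tensorVec φ χ),
    h (tensorVec ξ ζ) (tensorVec φ χ), h (tensorVec ξ ζ) (tensorVec ξ χ),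
    h (tensorVec ξ ζ) (tensorVec φ ζ), h (tensorVec ξ χ) (tensorVec φ ζ)]
  ring

/-- At a zero of a witness the linear term of the expansion is absent. -/
lemma biquadraticForm_add_smul_of_zero {A : Matrix (Fin Na × Fin Nb) (Fin Na × Fin Nb) ℂ}
    (hA : A ∈ witnesses Na Nb) {φ : Fin Na → ℂ} {χ : Fin Nb → ℂ} (h0 : biquadraticForm A φ χ = 0)
    (ξ : Fin Na → ℂ) (ζ : Fin Nb → ℂ) (t : ℝ) :
    biquadraticForm A (φ + t • ξ) (χ + t • ζ) =
      t ^ 2 * (hessianForm A φ χ ξ ζ + t * cubicTerm A φ χ ξ ζ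
        + t ^ 2 * biquadraticForm A ξ ζ) := by
  obtain ⟨hH, hpos⟩ := (mem_witnesses_iff A).mp hA
  have hexp := biquadraticForm_add_smul hH φ ξ χ ζ
  rw [h0] at hexp
  generalize 2 * (star (tensorVec φ χ) ⬝ᵥ (A *ᵥ (tensorVec ξ χ + tensorVec φ ζ))).re = b at hexp
  generalize hessianForm A φ χ ξ ζ = c at hexp ⊢
  generalize cubicTerm A φ χ ξ ζ = d at hexp ⊢
  generalize biquadraticForm A ξ ζ = e at hexp ⊢
  -- Since `f_A ≥ 0` on the whole line, `t = 0` is a minimum, and `b` is the derivative there.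
  have hmin : IsLocalMin (fun t : ℝ => t * b + t ^ 2 * (c + t * d + t ^ 2 * e)) 0 := by
    refine Filter.Eventually.of_forall fun s => ?_
    have h1 := hpos (φ + s • ξ) (χ + s • ζ)
    have h2 := hexp s
    simp only
    linarith
  have hd : HasDerivAt (fun t : ℝ => t * b + t ^ 2 * (c + t * d + t ^ 2 * e)) b 0 := by
    have h1 : HasDerivAt (fun t : ℝ => t * b + t ^ 2 * (c + t * d + t ^ 2 * e)) _ 0 :=
      ((hasDerivAt_id (0 : ℝ)).mul_const b).add (((hasDerivAt_id (0 : ℝ)).pow 2).mul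
        ((((hasDerivAt_id (0 : ℝ)).mul_const d).const_add c).add
          (((hasDerivAt_id (0 : ℝ)).pow 2).mul_const e)))
    convert h1 using 1
    simp
  have hb : b = 0 := hmin.hasDerivAt_eq_zero hd
  rw [hexp, hb]
  ring

lemma continuous_hessianForm (A : Matrix (Fin Na × Fin Nb) (Fin Na × Fin Nb) ℂ)
    (φ : Fin Na → ℂ) (χ : Fin Nb → ℂ) :
    Continuous fun x : (Fin Na → ℂ) × (Fin Nb → ℂ) => hessianForm A φ χ x.1 x.2 := by
  simp only [hessianForm, tensorVec, dotProduct, mulVec, Pi.star_apply]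
  fun_prop

lemma continuous_cubicTerm (A : Matrix (Fin Na × Fin Nb) (Fin Na × Fin Nb) ℂ)
    (φ : Fin Na → ℂ) (χ : Fin Nb → ℂ) :
    Continuous fun x : (Fin Na → ℂ) × (Fin Nb → ℂ) => cubicTerm A φ χ x.1 x.2 := by
  simp only [cubicTerm, tensorVec, dotProduct, mulVec, Pi.star_apply, Pi.add_apply]
  fun_prop

/-! ### Domination of one witness by another -/

/-- Near a common zero, quadratic for `Ω`, a multiple of `f_Ω` dominates `f_Γ` in the directions
orthogonal to the zero. -/
lemma exists_mul_le_of_isQuadraticZero {Ω Γ : Matrix (Fin Na × Fin Nb) (Fin Na × Fin Nb) ℂ}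
    (hΩ : Ω ∈ witnesses Na Nb) (hΓ : Γ ∈ witnesses Na Nb) {φ : Fin Na → ℂ} {χ : Fin Nb → ℂ}
    (hq : IsQuadraticZero Ω φ χ) (h0 : biquadraticForm Γ φ χ = 0) :
    ∃ ε > 0, ∃ δ > 0, ∀ (ξ : Fin Na → ℂ) (ζ : Fin Nb → ℂ), star φ ⬝ᵥ ξ = 0 → star χ ⬝ᵥ ζ = 0 →
      ‖(ξ, ζ)‖ < δ →
      ε * biquadraticForm Γ (φ + ξ) (χ + ζ) ≤ biquadraticForm Ω (φ + ξ) (χ + ζ) := by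
  obtain ⟨⟨-, -, hz⟩, hpos⟩ := hq
  let S : Set ((Fin Na → ℂ) × (Fin Nb → ℂ)) :=
    Metric.sphere 0 1 ∩ {x | star φ ⬝ᵥ x.1 = 0 ∧ star χ ⬝ᵥ x.2 = 0}
  have hS : IsCompact S := by
    refine (isCompact_sphere _ _).inter_right ((isClosed_eq ?_ ?_).inter (isClosed_eq ?_ ?_)) <;>
    first
    | exact continuous_const
    | simp only [dotProduct]; fun_prop
  have hbound : ∀ g : (Fin Na → ℂ) × (Fin Nb → ℂ) → ℝ, Continuous g →
      ∃ M > 0, ∀ x ∈ S, |g x| ≤ M := by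
    intro g hg
    obtain ⟨M, hM⟩ := hS.exists_bound_of_continuousOn hg.continuousOn
    exact ⟨max M 1, by positivity, fun x hx => (hM x hx).trans (le_max_left _ _)⟩
  obtain ⟨c, hc, hcS⟩ : ∃ c > 0, ∀ x ∈ S, c ≤ hessianForm Ω φ χ x.1 x.2 := by
    refine hS.exists_forall_le' (continuous_hessianForm Ω φ χ).continuousOn ?_
    rintro ⟨ξ, ζ⟩ ⟨hx, h1, h2⟩
    refine hpos ξ ζ h1 h2 fun h => ?_
    rw [h] at hx
    simp at hx
  obtain ⟨M₁, hM₁, h₁⟩ := hbound _ (continuous_cubicTerm Ω φ χ)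
  obtain ⟨M₂, hM₂, h₂⟩ := hbound _ (continuous_hessianForm Γ φ χ)
  obtain ⟨M₃, hM₃, h₃⟩ := hbound _ (continuous_cubicTerm Γ φ χ)
  obtain ⟨M₄, hM₄, h₄⟩ := hbound _ (continuous_biquadraticForm Γ)
  -- With `t` the norm of the variation, `t M₁ < c / 2` leaves `f_Ω ≥ (c / 2) t²`, while `t < 1`
  -- gives `f_Γ ≤ (M₂ + M₃ + M₄) t²`; `ε` is the ratio.
  refine ⟨c / 2 / (M₂ + M₃ + M₄), by positivity, min 1 (c / 2 / M₁), by positivity,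
    fun ξ ζ hξ hζ hlt => ?_⟩
  have hΩpos := ((mem_witnesses_iff Ω).mp hΩ).2
  rcases eq_or_ne (ξ, ζ) 0 with hzero | hne
  · obtain ⟨rfl, rfl⟩ := Prod.mk_eq_zero.mp hzero
    simp [h0, hz]
  set t := ‖(ξ, ζ)‖ with ht
  have htpos : 0 < t := norm_pos_iff.mpr hne
  have ht1 : t < 1 := hlt.trans_le (min_le_left _ _)
  have htM : t * M₁ < c / 2 := (lt_div_iff₀ hM₁).mp (hlt.trans_le (min_le_right _ _))
  have hξt : ξ = t • (t⁻¹ • ξ) := by rw [smul_smul, mul_inv_cancel₀ htpos.ne', one_smul]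
  have hζt : ζ = t • (t⁻¹ • ζ) := by rw [smul_smul, mul_inv_cancel₀ htpos.ne', one_smul]
  have hmem : (t⁻¹ • ξ, t⁻¹ • ζ) ∈ S := by
    refine ⟨?_, ?_, ?_⟩
    · rw [mem_sphere_zero_iff_norm, ← Prod.smul_mk, norm_smul, Real.norm_eq_abs, abs_inv,
        abs_of_pos htpos, ← ht, inv_mul_cancel₀ htpos.ne']
    · simp [dotProduct_smul, hξ]
    · simp [dotProduct_smul, hζ]
  rw [hξt, hζt, biquadraticForm_add_smul_of_zero hΩ hz, biquadraticForm_add_smul_of_zero hΓ h0,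
    mul_left_comm]
  generalize t⁻¹ • ξ = ξ' at hmem ⊢
  generalize t⁻¹ • ζ = ζ' at hmem ⊢
  refine mul_le_mul_of_nonneg_left ?_ (sq_nonneg t)
  have k0 := hcS _ hmem
  have k1 := neg_le_of_abs_le (h₁ _ hmem)
  have k2 := le_of_abs_le (h₂ _ hmem)
  have k3 := le_of_abs_le (h₃ _ hmem)
  have k4 := le_of_abs_le (h₄ _ hmem)
  simp only at k0 k1 k2 k3 k4
  have hΩ' : c / 2 ≤ hessianForm Ω φ χ ξ' ζ' + t * cubicTerm Ω φ χ ξ' ζ'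
      + t ^ 2 * biquadraticForm Ω ξ' ζ' := by
    have := mul_nonneg (sq_nonneg t) (hΩpos ξ' ζ')
    have := mul_le_mul_of_nonneg_left k1 htpos.le
    linarith
  refine le_trans ?_ hΩ'
  rw [div_mul_eq_mul_div, div_le_iff₀ (by positivity)]
  refine mul_le_mul_of_nonneg_left ?_ (by positivity)
  have e3 : t * cubicTerm Γ φ χ ξ' ζ' ≤ M₃ :=
    (mul_le_mul_of_nonneg_left k3 htpos.le).trans (mul_le_of_le_one_left hM₃.le ht1.le)
  have e4 : t ^ 2 * biquadraticForm Γ ξ' ζ' ≤ M₄ :=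
    (mul_le_mul_of_nonneg_left k4 (sq_nonneg t)).trans
      (mul_le_of_le_one_left hM₄.le (pow_le_one₀ htpos.le ht1.le))
  linarith

open scoped ComplexOrder in
/-- Vectors near `v` are nonzero multiples of `v + ξ` with `ξ` small and orthogonal to `v`. -/
lemma eventually_exists_eq_smul_add {n : ℕ} {v : Fin n → ℂ} (hv : v ≠ 0) {δ : ℝ} (hδ : 0 < δ) :
    ∀ᶠ x in nhds v, ∃ (a : ℂ) (ξ : Fin n → ℂ), star v ⬝ᵥ ξ = 0 ∧ ‖ξ‖ < δ ∧ x = a • (v + ξ) := by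
  have hvv : star v ⬝ᵥ v ≠ 0 := (dotProduct_star_self_pos_iff.mpr hv).ne'
  -- The coefficient of the orthogonal projection onto `v`; it is near 1 close to `v`, so it can be
  -- divided out.
  let s : (Fin n → ℂ) → ℂ := fun x => star v ⬝ᵥ x / star v ⬝ᵥ v
  have hs : Continuous s := by
    simp only [s, dotProduct]
    fun_prop
  have hs1 : s v = 1 := div_self hvv
  have hs0 : ∀ᶠ x in nhds v, s x ≠ 0 :=
    hs.continuousAt.eventually_ne (by rw [hs1]; exact one_ne_zero)
  have hξ : ContinuousAt (fun x => ‖(s x)⁻¹ • x - v‖) v :=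
    (((hs.continuousAt.inv₀ (by rw [hs1]; exact one_ne_zero)).smul continuousAt_id).sub
      continuousAt_const).norm
  have hlt : ∀ᶠ x in nhds v, ‖(s x)⁻¹ • x - v‖ < δ :=
    hξ.eventually_lt continuousAt_const (by simpa [hs1] using hδ)
  filter_upwards [hs0, hlt] with x hx0 hxlt
  refine ⟨s x, (s x)⁻¹ • x - v, ?_, hxlt, ?_⟩
  · have hne : star v ⬝ᵥ x ≠ 0 := fun h => hx0 (by simp [s, h])
    simp only [dotProduct_sub, dotProduct_smul, smul_eq_mul, s]
    field_simp
    ring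
  · rw [add_sub_cancel, smul_smul, mul_inv_cancel₀ hx0, one_smul]

/-- If `f_Γ` vanishes at all zeros of `Ω`, and these are quadratic, then a multiple of `f_Ω`
dominates `f_Γ`. -/
lemma exists_mul_biquadraticForm_le {Ω Γ : Matrix (Fin Na × Fin Nb) (Fin Na × Fin Nb) ℂ}
    (hΩ : Ω ∈ witnesses Na Nb) (hΓ : Γ ∈ witnesses Na Nb)
    (hq : ∀ φ χ, IsZero Ω φ χ → IsQuadraticZero Ω φ χ)
    (h0 : ∀ φ χ, IsZero Ω φ χ → biquadraticForm Γ φ χ = 0) :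
    ∃ ε > 0, ∀ φ χ, ε * biquadraticForm Γ φ χ ≤ biquadraticForm Ω φ χ := by
  have hΩpos := ((mem_witnesses_iff Ω).mp hΩ).2
  have hΓpos := ((mem_witnesses_iff Γ).mp hΓ).2
  let K : Set ((Fin Na → ℂ) × (Fin Nb → ℂ)) := Metric.sphere 0 1 ×ˢ Metric.sphere 0 1
  have hK : IsCompact K := (isCompact_sphere _ _).prod (isCompact_sphere _ _)
  obtain ⟨ε, hε, hεK⟩ : ∃ ε > 0, ∀ x ∈ K,
      ε * biquadraticForm Γ x.1 x.2 ≤ biquadraticForm Ω x.1 x.2 := by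
    -- Because `f_Γ ≥ 0`, the smaller `ε` serves a union, so only a local bound at each point is
    -- needed.
    refine hK.induction_on (p := fun s => ∃ ε > 0, ∀ x ∈ s,
      ε * biquadraticForm Γ x.1 x.2 ≤ biquadraticForm Ω x.1 x.2) ⟨1, one_pos, by simp⟩ ?_ ?_ ?_
    · rintro s t hst ⟨ε, hε, h⟩
      exact ⟨ε, hε, fun x hx => h x (hst hx)⟩
    · rintro s t ⟨ε, hε, h⟩ ⟨ε', hε', h'⟩
      refine ⟨min ε ε', lt_min hε hε', ?_⟩
      rintro x (hx | hx)
      · exact (mul_le_mul_of_nonneg_right (min_le_left _ _) (hΓpos _ _)).trans (h x hx)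
      · exact (mul_le_mul_of_nonneg_right (min_le_right _ _) (hΓpos _ _)).trans (h' x hx)
    · rintro ⟨φ, χ⟩ ⟨hφ, hχ⟩
      suffices ∃ ε > 0, ∀ᶠ x in nhds (φ, χ),
          ε * biquadraticForm Γ x.1 x.2 ≤ biquadraticForm Ω x.1 x.2 by
        obtain ⟨ε, hε, h⟩ := this
        exact ⟨_, mem_nhdsWithin_of_mem_nhds h, ε, hε, fun x hx => hx⟩
      have hφ0 : φ ≠ 0 := fun h => by simp [h] at hφ
      have hχ0 : χ ≠ 0 := fun h => by simp [h] at hχ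
      rcases (hΩpos φ χ).eq_or_lt with hzero | hpos
      · have hz : IsZero Ω φ χ := ⟨hφ0, hχ0, hzero.symm⟩
        obtain ⟨ε, hε, δ, hδ, h⟩ := exists_mul_le_of_isQuadraticZero hΩ hΓ (hq _ _ hz) (h0 _ _ hz)
        refine ⟨ε, hε, ?_⟩
        rw [nhds_prod_eq]
        filter_upwards [(eventually_exists_eq_smul_add hφ0 hδ).prod_mk
          (eventually_exists_eq_smul_add hχ0 hδ)] with x hx
        obtain ⟨⟨a, ξ, hξ, hξδ, hxa⟩, b, ζ, hζ, hζδ, hxb⟩ := hx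
        rw [hxa, hxb, biquadraticForm_smul_smul, biquadraticForm_smul_smul, mul_left_comm]
        exact mul_le_mul_of_nonneg_left
          (h ξ ζ hξ hζ (by rw [Prod.norm_mk]; exact max_lt hξδ hζδ)) (sq_nonneg _)
      · have hM : 0 < biquadraticForm Γ φ χ + 1 := by linarith [hΓpos φ χ]
        refine ⟨biquadraticForm Ω φ χ / 2 / (biquadraticForm Γ φ χ + 1), by positivity, ?_⟩
        have e1 := (continuous_biquadraticForm Γ).continuousAt.eventually_lt
          (x₀ := (φ, χ)) (g := fun _ => biquadraticForm Γ φ χ + 1) continuousAt_const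
          (by simp)
        have e2 := ContinuousAt.eventually_lt (x₀ := (φ, χ))
          (f := fun _ => biquadraticForm Ω φ χ / 2) continuousAt_const
          (continuous_biquadraticForm Ω).continuousAt (by simpa using hpos)
        filter_upwards [e1, e2] with x h1 h2
        refine le_trans ?_ h2.le
        rw [div_mul_eq_mul_div, div_le_iff₀ hM]
        exact mul_le_mul_of_nonneg_left h1.le (by positivity)
  refine ⟨ε, hε, fun φ χ => ?_⟩
  have hscale : ∀ {n : ℕ} (v : Fin n → ℂ), v = 0 ∨
      ∃ (a : ℂ) (u : Fin n → ℂ), u ∈ Metric.sphere 0 1 ∧ v = a • u := by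
    intro n v
    refine or_iff_not_imp_left.mpr fun hv => ?_
    have hn : (‖v‖ : ℂ) ≠ 0 := by exact_mod_cast norm_ne_zero_iff.mpr hv
    refine ⟨(‖v‖ : ℂ), (‖v‖ : ℂ)⁻¹ • v, ?_, by rw [smul_smul, mul_inv_cancel₀ hn, one_smul]⟩
    rw [mem_sphere_zero_iff_norm, norm_smul, norm_inv, Complex.norm_real, norm_norm,
      inv_mul_cancel₀ (norm_ne_zero_iff.mpr hv)]
  rcases hscale φ with rfl | ⟨a, u, hu, rfl⟩
  · simp [biquadraticForm, tensorVec, dotProduct]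
  rcases hscale χ with rfl | ⟨b, w, hw, rfl⟩
  · simp [biquadraticForm, tensorVec, dotProduct]
  rw [biquadraticForm_smul_smul, biquadraticForm_smul_smul, mul_left_comm]
  exact mul_le_mul_of_nonneg_left (hεK (u, w) ⟨hu, hw⟩) (sq_nonneg _)

/-! ### Extremality -/

/-- An extremal quadratic witness is determined by its zeros. -/
lemma eq_of_forall_isZero {Ω Γ : Matrix (Fin Na × Fin Nb) (Fin Na × Fin Nb) ℂ}
    (hext : IsExtremalWitness Ω) (hquad : IsQuadraticWitness Ω)
    (hΓ : Γ ∈ normalizedWitnesses Na Nb)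
    (h0 : ∀ φ χ, IsZero Ω φ χ → biquadraticForm Γ φ χ = 0) : Γ = Ω := by
  obtain ⟨hΩ, hmax⟩ := mem_extremePoints.mp hext
  obtain ⟨ε', hε', hle⟩ := exists_mul_biquadraticForm_le hΩ.1 hΓ.1 hquad.2 h0
  have hΓpos := ((mem_witnesses_iff Γ).mp hΓ.1).2
  obtain ⟨ε, hε, hε1, hεε⟩ : ∃ ε > 0, ε < 1 ∧ ε ≤ ε' :=
    ⟨min ε' (1 / 2), by positivity, (min_le_right _ _).trans_lt (by norm_num), min_le_left _ _⟩
  have h1ε : 0 < 1 - ε := by linarith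
  -- This makes `Ω` a proper convex combination of the normalized residual and `Γ`.
  have hmem : (1 - ε)⁻¹ • (Ω - ε • Γ) ∈ normalizedWitnesses Na Nb := by
    refine ⟨(mem_witnesses_iff _).mpr ⟨?_, fun φ χ => ?_⟩, ?_⟩
    · have hsm : ∀ (c : ℝ) {B : Matrix (Fin Na × Fin Nb) (Fin Na × Fin Nb) ℂ},
          B.IsHermitian → (c • B).IsHermitian := fun c B hB => by
        rw [IsHermitian, conjTranspose_smul, hB.eq, star_trivial]
      exact hsm _ (hΩ.1.1.sub (hsm _ hΓ.1.1))
    · rw [biquadraticForm_smul, biquadraticForm_sub, biquadraticForm_smul]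
      have h1 := hle φ χ
      have h2 := mul_le_mul_of_nonneg_right hεε (hΓpos φ χ)
      exact mul_nonneg (inv_nonneg.mpr h1ε.le) (by linarith)
    · rw [trace_smul, trace_sub, trace_smul, hΩ.2, hΓ.2]
      have : (1 - (ε : ℂ)) ≠ 0 := by exact_mod_cast h1ε.ne'
      simp [this]
  refine (hmax _ hmem _ hΓ ⟨1 - ε, ε, h1ε, hε, by ring, ?_⟩).2
  rw [smul_smul, mul_inv_cancel₀ h1ε.ne', one_smul, sub_add_cancel]

/-! ### Squared moduli have non-quadratic zeros -/

lemma exists_ne_zero_dotProduct_eq_zero {n : ℕ} (hn : 2 ≤ n) (w : Fin n → ℂ) :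
    ∃ v : Fin n → ℂ, v ≠ 0 ∧ w ⬝ᵥ v = 0 := by
  let i : Fin n := ⟨0, by omega⟩
  let j : Fin n := ⟨1, by omega⟩
  have hij : i ≠ j := by simp [i, j]
  by_cases hi : w i = 0
  · exact ⟨Pi.single i 1, by simp, by simp [hi]⟩
  · refine ⟨Pi.single j (w i) - Pi.single i (w j), fun h => hi ?_, ?_⟩
    · simpa [hij.symm] using congrFun h j
    · simp [dotProduct_sub, mul_comm]

/-- A functional `L(φ, χ)` that is additive in each variable, homogeneous in `φ` and homogeneous
up to an automorphism `σ` in `χ` cannot have `|L|² = f_Ω` with all zeros quadratic. -/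
lemma not_forall_isQuadraticZero_of_eq_norm_sq (hNa : 2 ≤ Na) (hNb : 2 ≤ Nb)
    {Ω : Matrix (Fin Na × Fin Nb) (Fin Na × Fin Nb) ℂ} (hΩ : Ω ∈ witnesses Na Nb)
    (hq : ∀ φ χ, IsZero Ω φ χ → IsQuadraticZero Ω φ χ) (σ : ℂ ≃+* ℂ)
    (hσ : ∀ t : ℝ, σ t = t)
    (L : (Fin Na → ℂ) →ₗ[ℂ] (Fin Nb → ℂ) →ₛₗ[(σ : ℂ →+* ℂ)] ℂ) (c : ℝ)
    (hL : ∀ φ χ, biquadraticForm Ω φ χ = c * ‖L φ χ‖ ^ 2) : False := by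
  obtain ⟨χ, hχ⟩ : ∃ χ : Fin Nb → ℂ, χ ≠ 0 := ⟨fun _ => 1, fun h => by
    simpa using congrFun h ⟨0, by omega⟩⟩
  obtain ⟨φ, hφ, hφL⟩ := exists_ne_zero_dotProduct_eq_zero hNa (fun i => L (Pi.single i 1) χ)
  have hLz : L φ χ = 0 := by
    rw [← hφL, dotProduct]
    conv_lhs => rw [pi_eq_sum_univ' φ]
    simp [map_sum, LinearMap.sum_apply, mul_comm]
  have hz : IsZero Ω φ χ := ⟨hφ, hχ, by simp [hL, hLz]⟩
  obtain ⟨ξ, hξ, hξφ⟩ := exists_ne_zero_dotProduct_eq_zero hNa (star φ)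
  obtain ⟨ζ, hζ, hζχ⟩ := exists_ne_zero_dotProduct_eq_zero hNb (star χ)
  obtain ⟨ξ', ζ', hξ', hζ', hne, hker⟩ : ∃ (ξ' : Fin Na → ℂ) (ζ' : Fin Nb → ℂ),
      star φ ⬝ᵥ ξ' = 0 ∧ star χ ⬝ᵥ ζ' = 0 ∧ (ξ', ζ') ≠ (0, 0) ∧ L ξ' χ + L φ ζ' = 0 := by
    by_cases ha : L ξ χ = 0
    · exact ⟨ξ, 0, hξφ, by simp, by simp [hξ], by simp [ha]⟩
    -- Two values in `ℂ` are always dependent; `σ.symm` undoes the twist of scalars in the second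
    -- argument.
    · refine ⟨L φ ζ • ξ, -(σ.symm (L ξ χ)) • ζ, by simp [hξφ], by simp [hζχ], ?_, ?_⟩
      · simp [hζ, ha]
      · simp only [map_smul, LinearMap.smul_apply, LinearMap.map_smulₛₗ, smul_eq_mul]
        simp
        ring
  have hH := (hq φ χ hz).2 ξ' ζ' hξ' hζ' hne
  -- Constant and linear parts of `L` cancel along this line, so `f_Ω` is purely quartic in `t`.
  have hexp : ∀ t : ℝ, c * (t ^ 4 * ‖L ξ' ζ'‖ ^ 2) =
      t ^ 2 * (hessianForm Ω φ χ ξ' ζ' + t * cubicTerm Ω φ χ ξ' ζ'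
        + t ^ 2 * biquadraticForm Ω ξ' ζ') := by
    intro t
    rw [← biquadraticForm_add_smul_of_zero hΩ hz.2.2, hL]
    have : L (φ + t • ξ') (χ + t • ζ') = (t : ℂ) ^ 2 * L ξ' ζ' := by
      have h1 : φ + t • ξ' = φ + (t : ℂ) • ξ' := by simp
      have h2 : χ + t • ζ' = χ + (t : ℂ) • ζ' := by simp
      rw [h1, h2]
      simp only [map_add, map_smul, LinearMap.add_apply, LinearMap.smul_apply,
        LinearMap.map_smulₛₗ, smul_eq_mul, RingHom.coe_coe, hσ, hLz]
      linear_combination (t : ℂ) * hker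
    rw [this, norm_mul, norm_pow, Complex.norm_real, mul_pow, ← pow_mul, Real.norm_eq_abs]
    congr 2
    exact (Even.pow_abs (by decide) t).symm
  -- The values at ±1 kill the cubic term; the value at 2 then forces the Hessian to be 0.
  have e1 := hexp 1
  have e2 := hexp (-1)
  have e3 := hexp 2
  norm_num at e1 e2 e3
  linarith

/-! ### Spanning by product vectors and by their partial conjugates -/

/-- The map `(φ, χ) ↦ ∑ w_{ij} φ_i σ(χ_j)`, semilinear in `χ`. -/
def tensorPairing (σ : ℂ ≃+* ℂ) (w : Fin Na × Fin Nb → ℂ) :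
    (Fin Na → ℂ) →ₗ[ℂ] (Fin Nb → ℂ) →ₛₗ[(σ : ℂ →+* ℂ)] ℂ :=
  LinearMap.mk₂'ₛₗ (RingHom.id ℂ) (σ : ℂ →+* ℂ) (fun φ χ => w ⬝ᵥ tensorVec φ (fun j => σ (χ j)))
    (fun φ φ' χ => by
      rw [← dotProduct_add]; congr 1; ext p; simp [tensorVec, add_mul])
    (fun a φ χ => by
      rw [← dotProduct_smul]; congr 1; ext p; simp [tensorVec, mul_assoc])
    (fun φ χ χ' => by
      rw [← dotProduct_add]; congr 1; ext p; simp [tensorVec, mul_add])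
    (fun a φ χ => by
      rw [← dotProduct_smul]; congr 1; ext p; simp [tensorVec, mul_left_comm])

lemma tensorPairing_apply (σ : ℂ ≃+* ℂ) (w : Fin Na × Fin Nb → ℂ) (φ : Fin Na → ℂ)
    (χ : Fin Nb → ℂ) :
    tensorPairing σ w φ χ = w ⬝ᵥ tensorVec φ (fun j => σ (χ j)) := rfl

/-- Spanning criterion covering both the product vectors (`σ = id`) and the partially conjugated
ones (`σ` the conjugation): it suffices that every squared modulus `|w · (φ ⊗ σ(χ))|²` is the
biquadratic form of a Hermitian matrix with trace `‖w‖²`. -/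
lemma span_tensorVec_eq_top (hNa : 2 ≤ Na) (hNb : 2 ≤ Nb)
    {Ω : Matrix (Fin Na × Fin Nb) (Fin Na × Fin Nb) ℂ}
    (hext : IsExtremalWitness Ω) (hquad : IsQuadraticWitness Ω) (σ : ℂ ≃+* ℂ)
    (hσ : ∀ t : ℝ, σ t = t)
    (hΓ : ∀ w : Fin Na × Fin Nb → ℂ, ∃ Γ : Matrix (Fin Na × Fin Nb) (Fin Na × Fin Nb) ℂ,
      Γ.IsHermitian ∧ trace Γ = ((∑ p, ‖w p‖ ^ 2 : ℝ) : ℂ) ∧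
        ∀ φ χ, biquadraticForm Γ φ χ = ‖tensorPairing σ w φ χ‖ ^ 2) :
    Submodule.span ℂ {ψ : Fin Na × Fin Nb → ℂ | ∃ (φ : Fin Na → ℂ) (χ : Fin Nb → ℂ),
      IsZero Ω φ χ ∧ ψ = tensorVec φ (fun j => σ (χ j))} = ⊤ := by
  by_contra hspan
  obtain ⟨f, hf, hker⟩ := Submodule.exists_le_ker_of_lt_top _ (lt_top_iff_ne_top.mpr hspan)
  -- The coordinates of a nonzero functional that annihilates the span.
  let w : Fin Na × Fin Nb → ℂ := fun p => f (Pi.single p 1)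
  have hfw : ∀ v, f v = w ⬝ᵥ v := by
    intro v
    rw [dotProduct]
    conv_lhs => rw [pi_eq_sum_univ' v]
    simp [map_sum, mul_comm, w]
  have hw : ∃ p, w p ≠ 0 := by
    by_contra! h
    refine hf (LinearMap.ext fun v => ?_)
    simp [hfw, dotProduct, h]
  obtain ⟨Γ, hH, htr, hform⟩ := hΓ w
  have hτ : 0 < ∑ p, ‖w p‖ ^ 2 := by
    obtain ⟨p, hp⟩ := hw
    exact Finset.sum_pos' (fun _ _ => by positivity) ⟨p, Finset.mem_univ _, by positivity⟩
  generalize ∑ p, ‖w p‖ ^ 2 = τ at hτ htr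
  have hform' : ∀ φ χ, biquadraticForm (τ⁻¹ • Γ) φ χ = τ⁻¹ * ‖tensorPairing σ w φ χ‖ ^ 2 :=
    fun φ χ => by rw [biquadraticForm_smul, hform]
  have hmem : τ⁻¹ • Γ ∈ normalizedWitnesses Na Nb := by
    refine ⟨(mem_witnesses_iff _).mpr ⟨?_, fun φ χ => ?_⟩, ?_⟩
    · rw [IsHermitian, conjTranspose_smul, hH.eq, star_trivial]
    · rw [hform']
      positivity
    · have : (τ : ℂ) ≠ 0 := by exact_mod_cast hτ.ne'
      simp [trace_smul, htr, this]
  have heq : τ⁻¹ • Γ = Ω := by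
    refine eq_of_forall_isZero hext hquad hmem fun φ χ hz => ?_
    have h0 : f (tensorVec φ (fun j => σ (χ j))) = 0 :=
      hker (Submodule.subset_span ⟨φ, χ, hz, rfl⟩)
    rw [hform', tensorPairing_apply, ← hfw, h0]
    simp
  exact not_forall_isQuadraticZero_of_eq_norm_sq hNa hNb hquad.1.1 hquad.2 σ hσ
    (tensorPairing σ w) τ⁻¹ (heq ▸ hform')

lemma exists_biquadraticForm_eq_norm_sq (w : Fin Na × Fin Nb → ℂ) :
    ∃ Γ : Matrix (Fin Na × Fin Nb) (Fin Na × Fin Nb) ℂ,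
      Γ.IsHermitian ∧ trace Γ = ((∑ p, ‖w p‖ ^ 2 : ℝ) : ℂ) ∧
        ∀ φ χ, biquadraticForm Γ φ χ = ‖tensorPairing (RingEquiv.refl ℂ) w φ χ‖ ^ 2 := by
  refine ⟨vecMulVec (star w) w, ?_, ?_, fun φ χ => ?_⟩
  · rw [IsHermitian, conjTranspose_vecMulVec, star_star]
  · simp [trace_vecMulVec, dotProduct, Complex.conj_mul']
  · rw [biquadraticForm, tensorPairing_apply, vecMulVec_mulVec, dotProduct_smul, op_smul_eq_mul,
      star_dotProduct_star, Complex.star_def]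
    simp only [RingEquiv.refl_apply]
    rw [Complex.conj_mul']
    norm_cast

/-- Partial transposition of the rank one operator `vecMulVec (star w) w` in the second factor
replaces `χ` by `χ*` in its form and preserves hermiticity and trace. -/
lemma exists_biquadraticForm_eq_norm_sq_conj (w : Fin Na × Fin Nb → ℂ) :
    ∃ Γ : Matrix (Fin Na × Fin Nb) (Fin Na × Fin Nb) ℂ,
      Γ.IsHermitian ∧ trace Γ = ((∑ p, ‖w p‖ ^ 2 : ℝ) : ℂ) ∧
        ∀ φ χ, biquadraticForm Γ φ χ = ‖tensorPairing (starRingAut (R := ℂ)) w φ χ‖ ^ 2 := by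
  refine ⟨of fun p q => star (w (p.1, q.2)) * w (q.1, p.2), ?_, ?_, fun φ χ => ?_⟩
  · ext p q
    simp [mul_comm]
  · simp [trace, Complex.conj_mul']
  · have key : star (tensorVec φ χ) ⬝ᵥ
        ((of fun p q : Fin Na × Fin Nb => star (w (p.1, q.2)) * w (q.1, p.2)) *ᵥ tensorVec φ χ) =
        star (w ⬝ᵥ tensorVec φ (star χ)) * (w ⬝ᵥ tensorVec φ (star χ)) := by
      simp only [dotProduct, mulVec, of_apply, star_sum]
      rw [Finset.sum_mul_sum]
      simp only [Finset.mul_sum, ← Finset.sum_product', Finset.univ_product_univ]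
      -- The involution exchanging the second-factor indices of the two summation variables.
      refine Finset.sum_nbij' (fun x => ((x.1.1, x.2.2), (x.2.1, x.1.2)))
        (fun x => ((x.1.1, x.2.2), (x.2.1, x.1.2))) (by simp) (by simp) (by simp) (by simp) ?_
      rintro ⟨⟨i, j⟩, k, l⟩ -
      simp [tensorVec]
      ring
    rw [biquadraticForm, key, Complex.star_def, Complex.conj_mul']
    norm_cast

end

end EntanglementWitness

theorem mainTheorem5 (Na Nb : ℕ) (hNa : 2 ≤ Na) (hNb : 2 ≤ Nb)
    (Ω : Matrix (Fin Na × Fin Nb) (Fin Na × Fin Nb) ℂ)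
    (hext : EntanglementWitness.IsExtremalWitness Ω)
    (hquad : EntanglementWitness.IsQuadraticWitness Ω) :
    Submodule.span ℂ {ψ : Fin Na × Fin Nb → ℂ | ∃ (φ : Fin Na → ℂ) (χ : Fin Nb → ℂ),
        EntanglementWitness.IsZero Ω φ χ ∧ ψ = EntanglementWitness.tensorVec φ χ} = ⊤ ∧
    Submodule.span ℂ {ψ : Fin Na × Fin Nb → ℂ | ∃ (φ : Fin Na → ℂ) (χ : Fin Nb → ℂ),
        EntanglementWitness.IsZero Ω φ χ ∧ ψ = EntanglementWitness.tensorVec φ (star χ)} = ⊤ := by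
  refine ⟨?_, ?_⟩
  · exact EntanglementWitness.span_tensorVec_eq_top hNa hNb hext hquad (RingEquiv.refl ℂ)
      (fun _ => rfl) EntanglementWitness.exists_biquadraticForm_eq_norm_sq
  · exact EntanglementWitness.span_tensorVec_eq_top hNa hNb hext hquad (starRingAut (R := ℂ))
      Complex.conj_ofReal EntanglementWitness.exists_biquadraticForm_eq_norm_sq_conj
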